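/- Let $Q_n$ be the $n$-dimensional hypercube: its vertices are the binary words of length $n$, two of them adjacent iff they differ in exactly one position. A vertex is even or odd according to its number of ones; call the vertices of one parity red and those of the other parity green (the statements hold for either choice). A $k$-path covering of a graph is a set of exactly $k$ vertex-disjoint paths that together contain all vertices of the graph. (a) Let $n\ge 4$, let $r_1,r_2$ be two distinct red vertices and $g_1,g_2,g_3,g_4$ four distinct green vertices of $Q_n$. Then $Q_n-\{r_1,r_2\}$ has a $2$-path covering in which one path connects $g_1$ to $g_2$ and the other connects $g_3$ to $g_4$. (b) The claim in (a) is false for $n=3$: there are two distinct red vertices $r_1,r_2$ and four distinct green vertices $g_1,\dots,g_4$ in $Q_3$ for which no such covering exists. (c) $[2,2,0,2]=4$, where the symbol is defined as follows. For a set $F$ of vertices of $Q_n$ (a fault), its mass is $|F|$ and its charge is the absolute value of the difference between its numbers of red and of green vertices. A pair of distinct vertices is charged if they have the same colour (a red or a green pair) and neutral otherwise. A set $E$ of disjoint pairs is in balance with $F$ if no pair in $E$ meets $F$ and the number of red minus the number of green vertices in $F$ equals the number of green minus the number of red pairs in $E$. One can freely prescribe ends for a path covering of $Q_n-F$ with $N$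 neutral and $O$ charged paths if there is at least one set of disjoint pairs in balance with $F$ that has exactly $N$ neutral and $O$ charged pairs, and every such set is the set of pairs of end vertices of the paths of some path covering (set of vertex-disjoint paths containing all vertices) of $Q_n-F$. Then $[M,C,N,O]$ is the smallest nonnegative integer $m\ge\log_2(M+C+2N+2O)$ such that for every $n\ge m$ and every fault $F$ of mass $M$ and charge $C$ in $Q_n$ one can freely prescribe ends for a path covering of $Q_n-F$ with $N$ neutral and $O$ charged paths. -/

import Mathlib

namespace HypercubePaths

/-- Vertices of the `n`-dimensional hypercube: binary words of length `n`. -/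
abbrev Vertex (n : ℕ) : Type := Fin n → Bool

/-- The hypercube `Q_n`: two words are adjacent iff they differ in exactly one position. -/
def cube (n : ℕ) : SimpleGraph (Vertex n) where
  Adj x y := hammingDist x y = 1
  symm := ⟨fun x y h => by rw [hammingDist_comm]; exact h⟩
  loopless := ⟨fun x h => by simp at h⟩

/-- A vertex is even (`true`) if it has an even number of ones, odd (`false`) otherwise. -/
def parity {n : ℕ} (x : Vertex n) : Bool :=
  decide (Even (Finset.univ.filter fun i => x i = true).card)

/-- A path in `G`, given with its two ends (a single vertex is a path of length `0`). -/
structure EndedPath {V : Type*} (G : SimpleGraph V) where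
  fst : V
  snd : V
  walk : G.Walk fst snd
  isPath : walk.IsPath

/-- The unordered pair of ends of a path. -/
def EndedPath.ends {V : Type*} {G : SimpleGraph V} (p : EndedPath G) : Sym2 V :=
  s(p.fst, p.snd)

/-- A path covering of `G`: a set of vertex disjoint paths that cover all vertices of `G`. -/
structure IsPathCovering {V : Type*} (G : SimpleGraph V) (C : Finset (EndedPath G)) : Prop where
  disjoint : ∀ p ∈ C, ∀ q ∈ C, p ≠ q → ∀ v, v ∈ p.walk.support → v ∉ q.walk.support
  covers : ∀ v, ∃ p ∈ C, v ∈ p.walk.support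

/-- A `k`-path covering: a path covering by exactly `k` paths. -/
def IsKPathCovering {V : Type*} (k : ℕ) (G : SimpleGraph V) (C : Finset (EndedPath G)) : Prop :=
  IsPathCovering G C ∧ C.card = k

/-- `Q_n - F`: the hypercube with the vertices of the fault `F` deleted. -/
abbrev cubeMinus {n : ℕ} (F : Finset (Vertex n)) : SimpleGraph {x : Vertex n // x ∉ F} :=
  (cube n).induce {x | x ∉ F}

/-- The ends of a path of `Q_n - F`, as vertices of `Q_n`. -/
def cubeEnds {n : ℕ} {F : Finset (Vertex n)} (p : EndedPath (cubeMinus F)) : Sym2 (Vertex n) :=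
  p.ends.map Subtype.val

/-- The claim in dimension `n`, where the vertices of parity `red` are called red and those of
the other parity green: for every two distinct red vertices and every four distinct green
vertices, the cube without the two red vertices has a 2-path covering with one path connecting
`g₁` to `g₂` and the other connecting `g₃` to `g₄`. -/
def TwoPathClaim (red : Bool) (n : ℕ) : Prop :=
  ∀ r₁ r₂ g₁ g₂ g₃ g₄ : Vertex n,
    parity r₁ = red → parity r₂ = red → r₁ ≠ r₂ →
    parity g₁ ≠ red → parity g₂ ≠ red → parity g₃ ≠ red → parity g₄ ≠ red →
    g₁ ≠ g₂ → g₁ ≠ g₃ → g₁ ≠ g₄ → g₂ ≠ g₃ → g₂ ≠ g₄ → g₃ ≠ g₄ →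
    ∃ C : Finset (EndedPath (cubeMinus ({r₁, r₂} : Finset (Vertex n)))),
      IsKPathCovering 2 (cubeMinus {r₁, r₂}) C ∧
      (∃ p ∈ C, cubeEnds p = s(g₁, g₂)) ∧ (∃ q ∈ C, cubeEnds q = s(g₃, g₄))

/-- The number of vertices of parity `b` in a fault. -/
def parityCount {n : ℕ} (b : Bool) (F : Finset (Vertex n)) : ℕ :=
  (F.filter fun x => parity x = b).card

/-- The charge of a fault: the absolute value of the difference between the numbers of its
vertices of the two parities. -/
def charge {n : ℕ} (F : Finset (Vertex n)) : ℕ :=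
  ((parityCount true F : ℤ) - (parityCount false F : ℤ)).natAbs

/-- Both elements of the pair have parity `b`. -/
def PairOfParity {n : ℕ} (b : Bool) (e : Sym2 (Vertex n)) : Prop :=
  ∀ x ∈ e, parity x = b

/-- A pair is charged if its two elements have the same parity. -/
def IsChargedPair {n : ℕ} (e : Sym2 (Vertex n)) : Prop :=
  ∃ b, PairOfParity b e

/-- A pair is neutral if its two elements have opposite parity. -/
def IsNeutralPair {n : ℕ} (e : Sym2 (Vertex n)) : Prop :=
  ∃ x ∈ e, ∃ y ∈ e, parity x ≠ parity y

/-- A set of disjoint pairs of vertices (each pair consisting of two different vertices). -/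
structure IsPairSet {n : ℕ} (E : Finset (Sym2 (Vertex n))) : Prop where
  not_diag : ∀ e ∈ E, ¬ e.IsDiag
  disjoint : ∀ e ∈ E, ∀ e' ∈ E, e ≠ e' → ∀ x, x ∈ e → x ∉ e'

/-- The number of pairs in `E` with both elements of parity `b`. -/
noncomputable def pairCount {n : ℕ} (b : Bool) (E : Finset (Sym2 (Vertex n))) : ℕ :=
  {e | e ∈ E ∧ PairOfParity b e}.ncard

/-- `E` is in balance with the fault `F`. The condition does not change when the roles of the
two parities are interchanged, so it does not matter which of them is called red. -/
def InBalance {n : ℕ} (F : Finset (Vertex n)) (E : Finset (Sym2 (Vertex n))) : Prop :=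
  (∀ e ∈ E, ∀ x ∈ e, x ∉ F) ∧
  (parityCount true F : ℤ) - parityCount false F = (pairCount false E : ℤ) - pairCount true E

/-- `E` is a set of disjoint pairs that is in balance with `F` and contains exactly `N` neutral
pairs and `O` charged pairs. -/
def IsAdmissible {n : ℕ} (F : Finset (Vertex n)) (N O : ℕ) (E : Finset (Sym2 (Vertex n))) :
    Prop :=
  IsPairSet E ∧ InBalance F E ∧
  {e | e ∈ E ∧ IsNeutralPair e}.ncard = N ∧ {e | e ∈ E ∧ IsChargedPair e}.ncard = O

/-- One can freely prescribe ends for a path covering of `Q_n - F` with `N` neutral paths and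
`O` charged paths. -/
def CanFreelyPrescribeEnds {n : ℕ} (F : Finset (Vertex n)) (N O : ℕ) : Prop :=
  (∃ E, IsAdmissible F N O E) ∧
  ∀ E, IsAdmissible F N O E →
    ∃ C : Finset (EndedPath (cubeMinus F)), IsPathCovering (cubeMinus F) C ∧
      {e | ∃ p ∈ C, cubeEnds p = e} = (E : Set (Sym2 (Vertex n)))

/-- The set whose smallest element is denoted `[M, C, N, O]`. -/
def admissibleDims (M C N O : ℕ) : Set ℕ :=
  {m | Real.logb 2 (M + C + 2 * N + 2 * O) ≤ m ∧
    ∀ n, m ≤ n → ∀ F : Finset (Vertex n), F.card = M → charge F = C →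
      CanFreelyPrescribeEnds F N O}

/-!
Split `Q_{n+1}` into two facets along a coordinate that separates the deleted vertices `r₁` and
`r₂`. According to the distribution of the four prescribed ends over the facets, paths of the two
facets are joined across edges between them: besides the claim for `Q_n` this takes Hamiltonian
paths of `Q_n` between vertices of opposite parity, and Hamiltonian paths of `Q_n - r` between
vertices of the parity opposite to that of `r`. The induction starts at `Q_4`, where a search by
evaluation, up to translation and the symmetries of the pairs, settles all cases.

In `Q_3` the four ends can be chosen such that the only remaining neighbour `s` of the end `a` has
both ends of the other path as its remaining neighbours; the path from `a` then gets stuck at `s`.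

For the symbol `[2, 2, 0, 2]`, charge `2` and mass `2` mean that the two deleted vertices have the
same parity, and balance forces both prescribed pairs to lie in the opposite parity.
-/

section Parity

variable {n : ℕ}

theorem parity_eq_decide_sum (x : Vertex n) :
    parity x = decide (∑ i, ((x i).toNat : ZMod 2) = 0) := by
  have hsum : (∑ i, ((x i).toNat : ZMod 2)) = (Finset.univ.filter fun i => x i = true).card := by
    rw [Finset.card_filter, Nat.cast_sum]
    exact Finset.sum_congr rfl fun i _ => by cases x i <;> simp
  rw [parity, hsum, decide_eq_decide, ZMod.natCast_eq_zero_iff_even]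

theorem parity_eq_parity_iff {x y : Vertex n} : parity x = parity y ↔ Even (hammingDist x y) := by
  have hsum : (∑ i, ((x i).toNat : ZMod 2)) + ∑ i, ((y i).toNat : ZMod 2) = hammingDist x y := by
    rw [hammingDist, Finset.card_filter, Nat.cast_sum, ← Finset.sum_add_distrib]
    refine Finset.sum_congr rfl fun i _ => ?_
    generalize x i = p, y i = q
    revert p q
    decide
  rw [← ZMod.natCast_eq_zero_iff_even, ← hsum, parity_eq_decide_sum, parity_eq_decide_sum,
    decide_eq_decide]
  generalize (∑ i, ((x i).toNat : ZMod 2)) = p, (∑ i, ((y i).toNat : ZMod 2)) = q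
  revert p q
  decide

theorem cube_adj {x y : Vertex n} : (cube n).Adj x y ↔ hammingDist x y = 1 := Iff.rfl

instance : DecidableRel (cube n).Adj := fun x y =>
  inferInstanceAs (Decidable (hammingDist x y = 1))

theorem parity_ne_of_adj {x y : Vertex n} (h : (cube n).Adj x y) : parity x ≠ parity y := by
  rw [Ne, parity_eq_parity_iff, cube_adj.1 h]
  decide

theorem parity_eq_of_adj_of_ne {x y r : Vertex n} (h : (cube n).Adj x y)
    (hx : parity x ≠ parity r) : parity y = parity r :=
  (Bool.eq_not_of_ne (parity_ne_of_adj h).symm).trans (Bool.eq_not_of_ne hx.symm).symm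

/-- The neighbour of `x` in direction `i`. -/
def flipAt (x : Vertex n) (i : Fin n) : Vertex n := Function.update x i (!x i)

theorem adj_flipAt (x : Vertex n) (i : Fin n) : (cube n).Adj x (flipAt x i) := by
  have hdiff : (Finset.univ.filter fun j => x j ≠ flipAt x i j) = {i} := by
    ext j
    rw [Finset.mem_filter_univ, Finset.mem_singleton, flipAt, Function.update_apply]
    split_ifs with hji <;> simp [hji]
  exact Finset.card_eq_one.2 ⟨i, hdiff⟩

theorem flipAt_injective (x : Vertex n) : Function.Injective (flipAt x) := by
  intro i j h
  by_contra hij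
  have hi := congrFun h i
  simp [flipAt, hij] at hi

theorem exists_adj_notMem (x : Vertex n) {L : Finset (Vertex n)} (hL : L.card < n) :
    ∃ y, (cube n).Adj x y ∧ y ∉ L := by
  obtain ⟨y, hy, hyL⟩ := Finset.exists_mem_notMem_of_card_lt_card
    (s := L) (t := Finset.univ.image (flipAt x))
    (by rwa [Finset.card_image_of_injective _ (flipAt_injective x), Finset.card_fin])
  obtain ⟨i, -, rfl⟩ := Finset.mem_image.1 hy
  exact ⟨_, adj_flipAt x i, hyL⟩

end Parity

section Facets

variable {n : ℕ} (i : Fin (n + 1)) (t u : Bool)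

theorem hammingDist_insertNth (x y : Vertex n) :
    hammingDist (i.insertNth t x : Vertex (n + 1)) (i.insertNth u y) =
      (if t = u then 0 else 1) + hammingDist x y := by
  simp only [hammingDist, Finset.card_filter]
  rw [Fin.sum_univ_succAbove _ i]
  simp

/-- The embedding of `Q_n` as the facet of `Q_{n+1}` whose vertices have `i`-th entry `t`. -/
def facet : cube n →g cube (n + 1) where
  toFun x := i.insertNth t x
  map_rel' {x y} h := by simpa [cube_adj, hammingDist_insertNth] using h

theorem hammingDist_facet (x y : Vertex n) :
    hammingDist (facet i t x) (facet i u y) = (if t = u then 0 else 1) + hammingDist x y :=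
  hammingDist_insertNth i t u x y

theorem facet_adj_facet_not (x : Vertex n) : (cube (n + 1)).Adj (facet i t x) (facet i (!t) x) := by
  simp [cube_adj, hammingDist_facet]

theorem facet_injective : Function.Injective (facet (n := n) i t) :=
  Fin.insertNth_right_injective (α := fun _ => Bool) (p := i) t

theorem facet_ne_facet_not (x y : Vertex n) : facet i t x ≠ facet i (!t) y := by
  rw [← hammingDist_pos, hammingDist_facet]
  simp

theorem parity_facet_eq_iff {x y : Vertex n} :
    parity (facet i t x) = parity (facet i t y) ↔ parity x = parity y := by
  simp [parity_eq_parity_iff, hammingDist_facet]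

theorem parity_facet_not_eq_iff {x y : Vertex n} :
    parity (facet i (!t) x) = parity (facet i t y) ↔ parity x ≠ parity y := by
  simp [parity_eq_parity_iff, hammingDist_facet, Nat.even_add]

variable {i t u}

theorem exists_facet_eq {x : Vertex (n + 1)} (h : x i = t) : ∃ y, facet i t y = x :=
  ⟨i.removeNth x, h ▸ Fin.insertNth_self_removeNth i x⟩

end Facets

section SpanningPaths

theorem support_append_cons {V : Type*} {G : SimpleGraph V} {a b c d : V} (p : G.Walk a b)
    (h : G.Adj b c) (q : G.Walk c d) :
    (p.append (.cons h q)).support = p.support ++ q.support := by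
  simp [SimpleGraph.Walk.support_append]

/-- The list contains every element of the type exactly once. -/
def IsEnumeration {V : Type*} [DecidableEq V] (l : List V) : Prop := ∀ x, l.count x = 1

theorem IsEnumeration.perm {V : Type*} [DecidableEq V] {l l' : List V} (h : IsEnumeration l)
    (hl : l'.Perm l) : IsEnumeration l' :=
  fun x => (hl.count_eq x).trans (h x)

theorem IsEnumeration.mem {V : Type*} [DecidableEq V] {l : List V} (h : IsEnumeration l) (x : V) :
    x ∈ l :=
  List.count_pos_iff.1 (by simp [h x])

theorem IsEnumeration.nodup {V : Type*} [DecidableEq V] {l : List V} (h : IsEnumeration l) :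
    l.Nodup :=
  List.nodup_iff_count_le_one.2 fun x => (h x).le

variable {V : Type*} [DecidableEq V] {G : SimpleGraph V} {F F' : List V} {a b c d s : V}

variable (G) in
/-- `G` without the vertices listed in `F` has a Hamiltonian path from `a` to `b`. -/
def HasSpanningPath (F : List V) (a b : V) : Prop :=
  ∃ p : G.Walk a b, IsEnumeration (F ++ p.support)

variable (G) in
/-- `G` without the vertices listed in `F` is covered by two disjoint paths, one from `a` to `b`
and one from `c` to `d`. -/
def HasSpanningPathPair (F : List V) (a b c d : V) : Prop :=
  ∃ (p : G.Walk a b) (q : G.Walk c d), IsEnumeration (F ++ (p.support ++ q.support))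

theorem HasSpanningPath.symm (h : HasSpanningPath G F a b) : HasSpanningPath G F b a := by
  obtain ⟨p, hp⟩ := h
  exact ⟨p.reverse, hp.perm (p.support_reverse ▸ p.support.reverse_perm.append_left F)⟩

theorem HasSpanningPathPair.perm (h : HasSpanningPathPair G F a b c d) (hF : F'.Perm F) :
    HasSpanningPathPair G F' a b c d := by
  obtain ⟨p, q, hpq⟩ := h
  exact ⟨p, q, hpq.perm (hF.append_right _)⟩

theorem HasSpanningPathPair.swap_deleted {r₁ r₂ : V}
    (h : HasSpanningPathPair G [r₁, r₂] a b c d) : HasSpanningPathPair G [r₂, r₁] a b c d :=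
  h.perm (List.Perm.swap r₁ r₂ [])

theorem HasSpanningPathPair.swap_pairs (h : HasSpanningPathPair G F a b c d) :
    HasSpanningPathPair G F c d a b := by
  obtain ⟨p, q, hpq⟩ := h
  exact ⟨q, p, hpq.perm (List.perm_append_comm.append_left _)⟩

theorem HasSpanningPathPair.swap_left (h : HasSpanningPathPair G F a b c d) :
    HasSpanningPathPair G F b a c d := by
  obtain ⟨p, q, hpq⟩ := h
  exact ⟨p.reverse, q, hpq.perm <|
    p.support_reverse ▸ (p.support.reverse_perm.append_right _).append_left F⟩

theorem HasSpanningPathPair.swap_right (h : HasSpanningPathPair G F a b c d) :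
    HasSpanningPathPair G F a b d c :=
  h.swap_pairs.swap_left.swap_pairs

theorem HasSpanningPathPair.extend (h : HasSpanningPathPair G (s :: F) a b c d)
    (hds : G.Adj d s) : HasSpanningPathPair G F a b c s := by
  obtain ⟨p, q, hpq⟩ := h
  exact ⟨p, q.concat hds, hpq.perm <| List.perm_iff_count.2 fun x => by
    simp only [SimpleGraph.Walk.support_concat, List.count_append,
      List.cons_append, List.count_cons, List.count_nil]
    omega⟩

end SpanningPaths

section FacetGluing

variable {n : ℕ} (i : Fin (n + 1)) (t : Bool) {F F' : List (Vertex n)} {a b c d p q s : Vertex n}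

theorem IsEnumeration.map_facet_append {l l' : List (Vertex n)} (h : IsEnumeration l)
    (h' : IsEnumeration l') : IsEnumeration (l.map (facet i t) ++ l'.map (facet i (!t))) := by
  intro x
  rw [List.count_append]
  rcases Bool.eq_or_eq_not (x i) t with hx | hx <;> obtain ⟨y, rfl⟩ := exists_facet_eq hx
  · rw [List.count_map_of_injective _ _ (facet_injective i t), h y, List.count_eq_zero.2]
    simpa using fun z _ => (facet_ne_facet_not i t y z).symm
  · rw [List.count_map_of_injective _ _ (facet_injective i (!t)), h' y, List.count_eq_zero.2]
    simpa using fun z _ => facet_ne_facet_not i t z y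

/-- The concatenation of a walk in one facet and a walk in the opposite facet, joined by the edge
between the two copies of `b`. -/
def joinFacets (p : (cube n).Walk a b) (q : (cube n).Walk b c) :
    (cube (n + 1)).Walk (facet i t a) (facet i (!t) c) :=
  (p.map (facet i t)).append (.cons (facet_adj_facet_not i t b) (q.map (facet i (!t))))

theorem support_joinFacets (p : (cube n).Walk a b) (q : (cube n).Walk b c) :
    (joinFacets i t p q).support =
      p.support.map (facet i t) ++ q.support.map (facet i (!t)) := by
  simp only [joinFacets, support_append_cons, SimpleGraph.Walk.support_map]

theorem HasSpanningPath.facets (h : HasSpanningPath (cube n) F a p)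
    (h' : HasSpanningPath (cube n) F' p b) :
    HasSpanningPath (cube (n + 1)) (F.map (facet i t) ++ F'.map (facet i (!t)))
      (facet i t a) (facet i (!t) b) := by
  obtain ⟨v, hv⟩ := h
  obtain ⟨w, hw⟩ := h'
  refine ⟨joinFacets i t v w,
    (hv.map_facet_append i t hw).perm <| List.perm_iff_count.2 fun x => ?_⟩
  simp only [support_joinFacets, List.map_append, List.count_append]
  omega

theorem HasSpanningPathPair.of_path_path (h : HasSpanningPath (cube n) F a b)
    (h' : HasSpanningPath (cube n) F' c d) :
    HasSpanningPathPair (cube (n + 1)) (F.map (facet i t) ++ F'.map (facet i (!t)))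
      (facet i t a) (facet i t b) (facet i (!t) c) (facet i (!t) d) := by
  obtain ⟨v, hv⟩ := h
  obtain ⟨w, hw⟩ := h'
  refine ⟨v.map (facet i t), w.map (facet i (!t)),
    (hv.map_facet_append i t hw).perm <| List.perm_iff_count.2 fun x => ?_⟩
  simp only [SimpleGraph.Walk.support_map, List.map_append, List.count_append]
  omega

theorem HasSpanningPathPair.of_pair_path (h : HasSpanningPathPair (cube n) F a b c s)
    (h' : HasSpanningPath (cube n) F' s d) :
    HasSpanningPathPair (cube (n + 1)) (F.map (facet i t) ++ F'.map (facet i (!t)))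
      (facet i t a) (facet i t b) (facet i t c) (facet i (!t) d) := by
  obtain ⟨v, v', hv⟩ := h
  obtain ⟨w, hw⟩ := h'
  refine ⟨v.map (facet i t), joinFacets i t v' w,
    (hv.map_facet_append i t hw).perm <| List.perm_iff_count.2 fun x => ?_⟩
  simp only [SimpleGraph.Walk.support_map, support_joinFacets, List.map_append, List.count_append]
  omega

theorem HasSpanningPathPair.of_pair_pair (h : HasSpanningPathPair (cube n) F a p c q)
    (h' : HasSpanningPathPair (cube n) F' p b q d) :
    HasSpanningPathPair (cube (n + 1)) (F.map (facet i t) ++ F'.map (facet i (!t)))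
      (facet i t a) (facet i (!t) b) (facet i t c) (facet i (!t) d) := by
  obtain ⟨v, v', hv⟩ := h
  obtain ⟨w, w', hw⟩ := h'
  refine ⟨joinFacets i t v w, joinFacets i t v' w',
    (hv.map_facet_append i t hw).perm <| List.perm_iff_count.2 fun x => ?_⟩
  simp only [support_joinFacets, List.map_append, List.count_append]
  omega

-- The edge from `a` to its successor `p` is replaced by the edge from `a` to `s`, a path of the
-- opposite facet between the copies of `s` and `p`, and the edge back to `p`.
theorem HasSpanningPathPair.detour (h : HasSpanningPathPair (cube n) (s :: F) a b c d)
    (has : (cube n).Adj a s) (hab : a ≠ b)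
    (h' : ∀ p, (cube n).Adj a p → p ≠ s → HasSpanningPath (cube n) F' s p) :
    HasSpanningPathPair (cube (n + 1)) (F.map (facet i t) ++ F'.map (facet i (!t)))
      (facet i t a) (facet i t b) (facet i t c) (facet i t d) := by
  obtain ⟨v, v', hv⟩ := h
  cases v with
  | nil => exact absurd rfl hab
  | @cons _ p _ hap v =>
    have hps : p ≠ s := by
      rintro rfl
      have hnd := hv.nodup
      rw [List.cons_append, List.nodup_cons] at hnd
      exact hnd.1 (by simp)
    obtain ⟨w, hw⟩ := h' p hap hps
    refine ⟨.cons ((facet i t).map_adj has) (.cons (facet_adj_facet_not i t s)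
        ((w.map (facet i (!t))).append
          (.cons (facet_adj_facet_not i t p).symm (v.map (facet i t))))),
      v'.map (facet i t), (hv.map_facet_append i t hw).perm <| List.perm_iff_count.2 fun x => ?_⟩
    simp only [SimpleGraph.Walk.support_cons, support_append_cons, SimpleGraph.Walk.support_map,
      List.map_append, List.map_cons, List.count_append, List.count_cons, List.cons_append]
    omega

end FacetGluing

section Laceability

variable {n : ℕ}

/-- Any two vertices of opposite parity are the ends of a Hamiltonian path of `Q_n`. -/
def IsLaceable (n : ℕ) : Prop :=
  ∀ u v : Vertex n, parity u ≠ parity v → HasSpanningPath (cube n) [] u v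

/-- Any two vertices of the parity opposite to `r` are the ends of a Hamiltonian path of
`Q_n - r`. -/
def IsHyperLaceable (n : ℕ) : Prop :=
  ∀ r u v : Vertex n, parity u ≠ parity r → parity v ≠ parity r → u ≠ v →
    HasSpanningPath (cube n) [r] u v

theorem exists_apply_eq_not {x y : Vertex n} (h : x ≠ y) : ∃ i, y i = !x i := by
  obtain ⟨i, hi⟩ := Function.ne_iff.1 h
  exact ⟨i, Bool.eq_not_of_ne hi.symm⟩

theorem IsLaceable.succ (hn : 1 ≤ n) (h : IsLaceable n) : IsLaceable (n + 1) := by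
  intro u v huv
  obtain ⟨i, hi⟩ := exists_apply_eq_not (ne_of_apply_ne parity huv)
  generalize hu : u i = t at hi
  obtain ⟨u, rfl⟩ := exists_facet_eq hu
  obtain ⟨v, rfl⟩ := exists_facet_eq hi
  rw [ne_comm, Ne, parity_facet_not_eq_iff, not_not] at huv
  obtain ⟨w, huw, -⟩ := exists_adj_notMem u (L := ∅) (by rw [Finset.card_empty]; omega)
  have hw := parity_ne_of_adj huw
  exact (h u w hw).facets i t (h w v (huv ▸ hw.symm))

theorem isLaceable_one : IsLaceable 1 := by
  have hedge : ∀ u v : Vertex 1, parity u ≠ parity v →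
      (cube 1).Adj u v ∧ ∀ x, [u, v].count x = 1 := by decide
  intro u v huv
  exact ⟨(hedge u v huv).1.toWalk, (hedge u v huv).2⟩

theorem isLaceable (hn : 1 ≤ n) : IsLaceable n := by
  induction n, hn using Nat.le_induction with
  | base => exact isLaceable_one
  | succ n hn ih => exact ih.succ hn

theorem IsHyperLaceable.hasSpanningPath_facets (hn : 2 ≤ n) (h : IsHyperLaceable n)
    {i : Fin (n + 1)} {r u v : Vertex (n + 1)} (hu : parity u ≠ parity r)
    (hv : parity v ≠ parity r) (hri : r i = u i) (hvi : v i = !u i) :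
    HasSpanningPath (cube (n + 1)) [r] u v := by
  generalize hui : u i = t at hri hvi
  obtain ⟨r, rfl⟩ := exists_facet_eq hri
  obtain ⟨u, rfl⟩ := exists_facet_eq hui
  obtain ⟨v, rfl⟩ := exists_facet_eq hvi
  rw [Ne, parity_facet_eq_iff] at hu
  rw [Ne, parity_facet_not_eq_iff, not_not] at hv
  obtain ⟨w, hrw, hwu⟩ := exists_adj_notMem r (L := {u}) (by rw [Finset.card_singleton]; omega)
  have hw := parity_ne_of_adj hrw
  have huw : u ≠ w := fun huw => hwu (Finset.mem_singleton.2 huw.symm)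
  exact (h r u w hu hw.symm huw).facets i t (isLaceable (by omega) w v (hv ▸ hw.symm))

theorem IsHyperLaceable.succ (hn : 2 ≤ n) (h : IsHyperLaceable n) : IsHyperLaceable (n + 1) := by
  intro r u v hu hv huv
  obtain ⟨i, hi⟩ := exists_apply_eq_not huv
  by_cases hri : r i = u i
  · exact h.hasSpanningPath_facets hn hu hv hri hi
  · have hrv : r i = v i := (Bool.eq_not_of_ne hri).trans hi.symm
    exact (h.hasSpanningPath_facets hn hv hu hrv (by simp [hi])).symm

theorem isHyperLaceable_two : IsHyperLaceable 2 := by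
  have hpath : ∀ r u v : Vertex 2, parity u ≠ parity r → parity v ≠ parity r → u ≠ v →
      ∃ w, ((cube 2).Adj u w ∧ (cube 2).Adj w v) ∧ ∀ x, [r, u, w, v].count x = 1 := by
    decide
  intro r u v hu hv huv
  obtain ⟨w, ⟨huw, hwv⟩, hcount⟩ := hpath r u v hu hv huv
  exact ⟨.cons huw hwv.toWalk, hcount⟩

theorem isHyperLaceable (hn : 2 ≤ n) : IsHyperLaceable n := by
  induction n, hn using Nat.le_induction with
  | base => exact isHyperLaceable_two
  | succ n hn ih => exact ih.succ hn

end Laceability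

section TwoLaceability

/-- Two deleted vertices `r₁`, `r₂` of the same parity, and four prescribed ends `a`, `b`, `c`, `d`
of the other parity. -/
structure IsEndChoice {n : ℕ} (r₁ r₂ a b c d : Vertex n) : Prop where
  ne : r₁ ≠ r₂
  parity_eq : parity r₁ = parity r₂
  parity_a : parity a ≠ parity r₁
  parity_b : parity b ≠ parity r₁
  parity_c : parity c ≠ parity r₁
  parity_d : parity d ≠ parity r₁
  nodup : [a, b, c, d].Nodup

/-- `Q_n` without any two vertices of one parity is covered by two disjoint paths whose four
different ends in the other parity can be prescribed. -/
def IsTwoLaceable (n : ℕ) : Prop :=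
  ∀ r₁ r₂ a b c d : Vertex n, IsEndChoice r₁ r₂ a b c d →
    HasSpanningPathPair (cube n) [r₁, r₂] a b c d

section Swap

variable {n : ℕ} {r₁ r₂ a b c d : Vertex n}

theorem IsEndChoice.nodup_append (h : IsEndChoice r₁ r₂ a b c d) : [r₁, r₂, a, b, c, d].Nodup := by
  obtain ⟨hr, hp, ha, hb, hc, hd, hnd⟩ := h
  have hne : ∀ x ∈ [a, b, c, d], parity x ≠ parity r₁ := by simp [ha, hb, hc, hd]
  refine List.nodup_cons.2 ⟨fun hmem => ?_, List.nodup_cons.2 ⟨fun hmem => ?_, hnd⟩⟩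
  · exact (List.mem_cons.1 hmem).elim hr fun hmem => hne r₁ hmem rfl
  · exact hne r₂ hmem hp.symm

theorem IsEndChoice.swap_deleted (h : IsEndChoice r₁ r₂ a b c d) : IsEndChoice r₂ r₁ a b c d := by
  obtain ⟨hr, hp, ha, hb, hc, hd, hnd⟩ := h
  rw [hp] at ha hb hc hd
  exact ⟨hr.symm, hp.symm, ha, hb, hc, hd, hnd⟩

theorem IsEndChoice.swap_left (h : IsEndChoice r₁ r₂ a b c d) : IsEndChoice r₁ r₂ b a c d :=
  ⟨h.ne, h.parity_eq, h.parity_b, h.parity_a, h.parity_c, h.parity_d,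
    (List.Perm.swap b a [c, d]).nodup_iff.1 h.nodup⟩

theorem IsEndChoice.swap_pairs (h : IsEndChoice r₁ r₂ a b c d) : IsEndChoice r₁ r₂ c d a b :=
  ⟨h.ne, h.parity_eq, h.parity_c, h.parity_d, h.parity_a, h.parity_b,
    (List.perm_append_comm (l₁ := [a, b]) (l₂ := [c, d])).nodup_iff.1 h.nodup⟩

theorem IsEndChoice.swap_right (h : IsEndChoice r₁ r₂ a b c d) : IsEndChoice r₁ r₂ a b d c :=
  h.swap_pairs.swap_left.swap_pairs

end Swap

section Step

variable {n : ℕ} {i : Fin (n + 1)} {t : Bool}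

-- Delete `s` too, let the second path end at a neighbour of `s`, and extend it to `s`.
theorem IsTwoLaceable.hasSpanningPathPair_singleton (hn : 4 ≤ n) (h : IsTwoLaceable n)
    {r s a b c : Vertex n} (hrs : r ≠ s) (hp : parity r = parity s) (ha : parity a ≠ parity r)
    (hb : parity b ≠ parity r) (hc : parity c ≠ parity r) (hnd : [a, b, c].Nodup) :
    HasSpanningPathPair (cube n) [r] a b c s := by
  obtain ⟨d, hsd, hd⟩ := exists_adj_notMem s (L := {a, b, c})
    (Finset.card_le_three.trans_lt (by omega))
  have hd' : parity d ≠ parity r := hp ▸ (parity_ne_of_adj hsd).symm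
  exact (h r s a b c d ⟨hrs, hp, ha, hb, hc, hd', by grind⟩).swap_deleted.extend hsd.symm

variable {r₁ r₂ a b c d : Vertex n}

theorem IsEndChoice.hasSpanningPathPair_two_two (hn : 2 ≤ n)
    (hE : IsEndChoice (facet i t r₁) (facet i (!t) r₂) (facet i t a) (facet i t b)
      (facet i (!t) c) (facet i (!t) d)) :
    HasSpanningPathPair (cube (n + 1)) [facet i t r₁, facet i (!t) r₂] (facet i t a) (facet i t b)
      (facet i (!t) c) (facet i (!t) d) := by
  obtain ⟨-, hr, ha, hb, hc, hd, hnd⟩ := hE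
  rw [hr] at hc hd
  simp only [Ne, parity_facet_eq_iff] at ha hb hc hd
  exact .of_path_path i t (F := [r₁]) (F' := [r₂]) (isHyperLaceable hn r₁ a b ha hb (by grind))
    (isHyperLaceable hn r₂ c d hc hd (by grind))

theorem IsEndChoice.hasSpanningPathPair_crossing (hn : 4 ≤ n) (h : IsTwoLaceable n)
    (hE : IsEndChoice (facet i t r₁) (facet i (!t) r₂) (facet i t a) (facet i (!t) b)
      (facet i t c) (facet i (!t) d)) :
    HasSpanningPathPair (cube (n + 1)) [facet i t r₁, facet i (!t) r₂] (facet i t a)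
      (facet i (!t) b) (facet i t c) (facet i (!t) d) := by
  obtain ⟨-, hr, ha, hb, hc, hd, hnd⟩ := hE
  rw [eq_comm, parity_facet_not_eq_iff] at hr
  simp only [Ne, parity_facet_eq_iff, parity_facet_not_eq_iff, not_not] at ha hb hc hd
  have hac : a ≠ c := by grind
  have hbd : b ≠ d := by grind
  clear hnd
  obtain ⟨p, hap, hp⟩ := exists_adj_notMem a (L := {r₁, b, d})
    (Finset.card_le_three.trans_lt (by omega))
  obtain ⟨q, hrq, hq⟩ := exists_adj_notMem r₁ (L := {a, c, r₂})
    (Finset.card_le_three.trans_lt (by omega))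
  have hpr₁ : parity p = parity r₁ := parity_eq_of_adj_of_ne hap ha
  have hqr₂ : parity q = parity r₂ := parity_eq_of_adj_of_ne hrq hr.symm
  refine .of_pair_pair i t (F := [r₁]) (F' := [r₂]) (p := p) (q := q) ?_ ?_
  · exact (h.hasSpanningPathPair_singleton hn (by grind) (by grind) (by grind) (by grind)
      (by grind) (by grind)).swap_pairs
  · exact (h.hasSpanningPathPair_singleton hn (by grind) (by grind) (by grind) (by grind)
      (by grind) (by grind)).swap_right

theorem IsEndChoice.hasSpanningPathPair_three (hn : 4 ≤ n) (h : IsTwoLaceable n)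
    (hE : IsEndChoice (facet i t r₁) (facet i (!t) r₂) (facet i t a) (facet i t b)
      (facet i t c) (facet i (!t) d)) :
    HasSpanningPathPair (cube (n + 1)) [facet i t r₁, facet i (!t) r₂] (facet i t a) (facet i t b)
      (facet i t c) (facet i (!t) d) := by
  obtain ⟨-, hr, ha, hb, hc, hd, hnd⟩ := hE
  rw [eq_comm, parity_facet_not_eq_iff] at hr
  simp only [Ne, parity_facet_eq_iff, parity_facet_not_eq_iff, not_not] at ha hb hc hd
  have habc : [a, b, c].Nodup := by grind
  clear hnd
  obtain ⟨s, has, hs⟩ := exists_adj_notMem a (L := {r₁, d})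
    (Finset.card_le_two.trans_lt (by omega))
  have hsr₁ : parity s = parity r₁ := parity_eq_of_adj_of_ne has ha
  refine .of_pair_path i t (F := [r₁]) (F' := [r₂]) (s := s) ?_ ?_
  · exact h.hasSpanningPathPair_singleton hn (by grind) hsr₁.symm ha hb hc habc
  · exact isHyperLaceable (by omega) r₂ s d (by grind) (by grind) (by grind)

theorem IsEndChoice.hasSpanningPathPair_four (hn : 2 ≤ n) (h : IsTwoLaceable n)
    (hE : IsEndChoice (facet i t r₁) (facet i (!t) r₂) (facet i t a) (facet i t b)
      (facet i t c) (facet i t d)) :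
    HasSpanningPathPair (cube (n + 1)) [facet i t r₁, facet i (!t) r₂] (facet i t a) (facet i t b)
      (facet i t c) (facet i t d) := by
  obtain ⟨-, hr, ha, hb, hc, hd, hnd⟩ := hE
  rw [eq_comm, parity_facet_not_eq_iff] at hr
  simp only [Ne, parity_facet_eq_iff] at ha hb hc hd
  obtain ⟨s, has, hs⟩ := exists_adj_notMem a (L := {r₁}) (by rw [Finset.card_singleton]; omega)
  have hsr₁ : s ≠ r₁ := by grind
  have hps : parity s = parity r₁ := parity_eq_of_adj_of_ne has ha
  have hchoice : IsEndChoice s r₁ a b c d :=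
    ⟨hsr₁, hps, hps ▸ ha, hps ▸ hb, hps ▸ hc, hps ▸ hd, List.Nodup.of_map (facet i t) hnd⟩
  refine .detour i t (F := [r₁]) (F' := [r₂]) (h s r₁ a b c d hchoice) has (by grind)
    fun p hap hpne => isHyperLaceable hn r₂ s p (hps ▸ hr.symm) ?_ hpne.symm
  rw [parity_eq_of_adj_of_ne hap ha]
  exact hr.symm

theorem IsEndChoice.hasSpanningPathPair_parallel (hn : 4 ≤ n) (h : IsTwoLaceable n)
    {r₁ r₂ a b c d : Vertex (n + 1)} (hE : IsEndChoice r₁ r₂ a b c d) (hr₁ : r₁ i = t)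
    (hr₂ : r₂ i = !t) (ha : a i = t) (hb : b i = t) :
    HasSpanningPathPair (cube (n + 1)) [r₁, r₂] a b c d := by
  obtain ⟨r₁, rfl⟩ := exists_facet_eq hr₁
  obtain ⟨r₂, rfl⟩ := exists_facet_eq hr₂
  obtain ⟨a, rfl⟩ := exists_facet_eq ha
  obtain ⟨b, rfl⟩ := exists_facet_eq hb
  rcases Bool.eq_or_eq_not (c i) t with hc | hc <;>
    rcases Bool.eq_or_eq_not (d i) t with hd | hd <;>
    obtain ⟨c, rfl⟩ := exists_facet_eq hc <;> obtain ⟨d, rfl⟩ := exists_facet_eq hd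
  · exact hE.hasSpanningPathPair_four (by omega) h
  · exact hE.hasSpanningPathPair_three hn h
  · exact (hE.swap_right.hasSpanningPathPair_three hn h).swap_right
  · exact hE.hasSpanningPathPair_two_two (by omega)

theorem IsEndChoice.hasSpanningPathPair_of_apply_eq (hn : 4 ≤ n) (h : IsTwoLaceable n)
    {r₁ r₂ a b c d : Vertex (n + 1)} (hE : IsEndChoice r₁ r₂ a b c d) (hr : r₂ i = !r₁ i)
    (hab : a i = b i) : HasSpanningPathPair (cube (n + 1)) [r₁, r₂] a b c d := by
  rcases Bool.eq_or_eq_not (a i) (r₁ i) with ha | ha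
  · exact hE.hasSpanningPathPair_parallel hn h rfl hr ha (hab ▸ ha)
  · exact (hE.swap_deleted.hasSpanningPathPair_parallel hn h hr (by simp) ha
      (hab ▸ ha)).swap_deleted

theorem IsEndChoice.hasSpanningPathPair_of_apply_ne (hn : 4 ≤ n) (h : IsTwoLaceable n)
    {r₁ r₂ a b c d : Vertex (n + 1)} (hE : IsEndChoice r₁ r₂ a b c d) (hr : r₂ i = !r₁ i)
    (hab : b i = !a i) (hcd : d i = !c i) :
    HasSpanningPathPair (cube (n + 1)) [r₁, r₂] a b c d := by
  generalize hr₁ : r₁ i = t at hr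
  obtain ⟨r₁, rfl⟩ := exists_facet_eq hr₁
  obtain ⟨r₂, rfl⟩ := exists_facet_eq hr
  rcases Bool.eq_or_eq_not (a i) t with ha | ha <;>
    rcases Bool.eq_or_eq_not (c i) t with hc | hc <;>
    simp only [ha, hc, Bool.not_not] at hab hcd <;>
    obtain ⟨a, rfl⟩ := exists_facet_eq ha <;> obtain ⟨b, rfl⟩ := exists_facet_eq hab <;>
    obtain ⟨c, rfl⟩ := exists_facet_eq hc <;> obtain ⟨d, rfl⟩ := exists_facet_eq hcd
  · exact hE.hasSpanningPathPair_crossing hn h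
  · exact (hE.swap_right.hasSpanningPathPair_crossing hn h).swap_right
  · exact (hE.swap_left.hasSpanningPathPair_crossing hn h).swap_left
  · exact (hE.swap_left.swap_right.hasSpanningPathPair_crossing hn h).swap_right.swap_left

theorem IsTwoLaceable.succ (hn : 4 ≤ n) (h : IsTwoLaceable n) : IsTwoLaceable (n + 1) := by
  intro r₁ r₂ a b c d hE
  obtain ⟨i, hi⟩ := exists_apply_eq_not hE.ne
  rcases Bool.eq_or_eq_not (b i) (a i) with hab | hab
  · exact hE.hasSpanningPathPair_of_apply_eq hn h hi hab.symm
  rcases Bool.eq_or_eq_not (d i) (c i) with hcd | hcd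
  · exact (hE.swap_pairs.hasSpanningPathPair_of_apply_eq hn h hi hcd.symm).swap_pairs
  · exact hE.hasSpanningPathPair_of_apply_ne hn h hi hab hcd

end Step

end TwoLaceability

section ExhaustiveSearch

variable {n : ℕ}

/-- The vertex that differs from `w` in the positions of the ones of the binary expansion of `k`.
With `w` as a parameter, one may always take a given vertex to have code `0`. -/
def vertexOfCode (w : Vertex n) (k : ℕ) : Vertex n := fun i => w i ^^ k.testBit i

theorem vertexOfCode_zero (w : Vertex n) : vertexOfCode w 0 = w := by
  funext i
  simp [vertexOfCode]

theorem exists_vertexOfCode_eq (w x : Vertex n) : ∃ k < 2 ^ n, vertexOfCode w k = x :=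
  ⟨Nat.ofBits fun i => w i ^^ x i, Nat.ofBits_lt_two_pow _, by
    funext i
    simp [vertexOfCode, Nat.testBit_ofBits_lt]⟩

theorem vertexOfCode_injOn (w : Vertex n) : Set.InjOn (vertexOfCode w) {k | k < 2 ^ n} := by
  intro k hk l hl h
  refine Nat.eq_of_testBit_eq fun i => ?_
  by_cases hi : i < n
  · exact Bool.xor_right_inj.1 (congrFun h ⟨i, hi⟩)
  · have hpow : 2 ^ n ≤ 2 ^ i := Nat.pow_le_pow_right two_pos (not_lt.1 hi)
    rw [Nat.testBit_lt_two_pow (lt_of_lt_of_le hk hpow),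
      Nat.testBit_lt_two_pow (lt_of_lt_of_le hl hpow)]

theorem vertexOfCode_adj_xor (w : Vertex n) (k : ℕ) {i : ℕ} (hi : i < n) :
    (cube n).Adj (vertexOfCode w k) (vertexOfCode w (k ^^^ 2 ^ i)) := by
  have hflip : vertexOfCode w (k ^^^ 2 ^ i) = flipAt (vertexOfCode w k) ⟨i, hi⟩ := by
    funext j
    by_cases hj : j = ⟨i, hi⟩
    · simp [vertexOfCode, flipAt, hj]
    · have hij : i ≠ j := fun h => hj (Fin.ext h.symm)
      simp [vertexOfCode, flipAt, hj, Nat.testBit_two_pow_of_ne hij]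
  exact hflip ▸ adj_flipAt _ _

theorem isEnumeration_map_vertexOfCode (w : Vertex n) :
    IsEnumeration ((List.range (2 ^ n)).map (vertexOfCode w)) := by
  intro x
  obtain ⟨k, hk, rfl⟩ := exists_vertexOfCode_eq w x
  refine List.count_eq_one_of_mem (List.nodup_range.map_on fun k hk l hl h => ?_)
    (List.mem_map_of_mem (List.mem_range.2 hk))
  exact vertexOfCode_injOn w (List.mem_range.1 hk) (List.mem_range.1 hl) h

/-- The codes of the vertices of `Q_n` that belong to the set with bit mask `A`. -/
def codes (n A : ℕ) : List ℕ := (List.range (2 ^ n)).filter A.testBit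

theorem mem_codes {A k : ℕ} : k ∈ codes n A ↔ k < 2 ^ n ∧ A.testBit k := by
  simp [codes]

theorem nodup_codes (n A : ℕ) : (codes n A).Nodup := List.nodup_range.filter _

theorem codes_perm_cons {A k : ℕ} (hk : k ∈ codes n A) :
    (codes n A).Perm (k :: codes n (A ^^^ 2 ^ k)) := by
  have hA := mem_codes.1 hk
  refine (List.perm_ext_iff_of_nodup (nodup_codes n A) ?_).2 fun l => ?_
  · exact List.nodup_cons.2 ⟨by simp [mem_codes, hA.2], nodup_codes n _⟩
  · rcases eq_or_ne k l with rfl | hkl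
    · simp [hk]
    · simp [mem_codes, hkl.symm, Nat.testBit_two_pow_of_ne hkl]

/-- The bit mask of the set of codes of vertices of `Q_n` that are not listed in `l`. The list must
be free of duplicates, since a code that is listed twice is toggled twice. -/
def maskCompl (n : ℕ) (l : List ℕ) : ℕ := l.foldr (fun k A => A ^^^ 2 ^ k) (2 ^ 2 ^ n - 1)

theorem append_codes_maskCompl_perm {l : List ℕ} (hl : l.Nodup) (hlt : ∀ k ∈ l, k < 2 ^ n) :
    (l ++ codes n (maskCompl n l)).Perm (List.range (2 ^ n)) := by
  induction l with
  | nil =>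
    refine .of_eq (List.filter_eq_self.2 fun k hk => ?_)
    simpa [maskCompl, Nat.testBit_two_pow_sub_one] using hk
  | cons k l ih =>
    obtain ⟨hkl, hl⟩ := List.nodup_cons.1 hl
    obtain ⟨hk, hlt⟩ := List.forall_mem_cons.1 hlt
    have hperm := ih hl hlt
    have hmem : k ∈ codes n (maskCompl n l) :=
      (List.mem_append.1 (hperm.mem_iff.2 (List.mem_range.2 hk))).resolve_left hkl
    exact List.perm_middle.symm.trans <| ((codes_perm_cons hmem).symm.append_left l).trans hperm

/-- Looks for a path of length at most `k` from `u` to `v` with all its inner vertices in the set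
with bit mask `A`, such that the mask of the remaining elements of this set satisfies `accept`. -/
def searchPath (n : ℕ) : ℕ → ℕ → ℕ → ℕ → (ℕ → Bool) → Bool
  | 0, _, _, _, _ => false
  | k + 1, A, u, v, accept => (List.range n).any fun i =>
    bif A.testBit (u ^^^ 2 ^ i) then
      searchPath n k (A ^^^ 2 ^ (u ^^^ 2 ^ i)) (u ^^^ 2 ^ i) v accept
    else u ^^^ 2 ^ i == v && accept A

theorem exists_walk_of_searchPath (w : Vertex n) {k A u v : ℕ} {accept : ℕ → Bool}
    (hu : u < 2 ^ n) (h : searchPath n k A u v accept = true) :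
    ∃ A', accept A' = true ∧ ∃ p : (cube n).Walk (vertexOfCode w u) (vertexOfCode w v),
      (p.support ++ (codes n A').map (vertexOfCode w)).Perm
        (([u, v] ++ codes n A).map (vertexOfCode w)) := by
  induction k generalizing A u with
  | zero => exact absurd h (by simp [searchPath])
  | succ k ih =>
    obtain ⟨i, hi, h⟩ := List.any_eq_true.1 (searchPath.eq_2 .. ▸ h)
    rw [List.mem_range] at hi
    have hadj := vertexOfCode_adj_xor w u hi
    have hlt : u ^^^ 2 ^ i < 2 ^ n := Nat.xor_lt_two_pow hu (Nat.pow_lt_pow_right one_lt_two hi)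
    generalize u ^^^ 2 ^ i = y at h hadj hlt
    cases hy : A.testBit y with
    | true =>
      rw [hy, cond_true] at h
      obtain ⟨A', hA', p, hp⟩ := ih hlt h
      have hA := (codes_perm_cons (mem_codes.2 ⟨hlt, hy⟩)).map (vertexOfCode w)
      refine ⟨A', hA', .cons hadj p, .cons _ ((hp.trans ?_).trans (hA.symm.cons _))⟩
      exact List.Perm.swap _ _ _
    | false =>
      rw [hy, cond_false, Bool.and_eq_true, beq_iff_eq] at h
      obtain ⟨rfl, hA⟩ := h
      exact ⟨A, hA, hadj.toWalk, .refl _⟩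

/-- Looks for two disjoint paths that connect `a` to `b` and `c` to `d` and together contain all
vertices of `Q_n` except `0` and `r`. -/
def searchPair (n r a b c d : ℕ) : Bool :=
  searchPath n (2 ^ n) (maskCompl n [0, r, a, b, c, d]) a b fun A =>
    searchPath n (2 ^ n) A c d (· == 0)

theorem hasSpanningPathPair_of_searchPair (w : Vertex n) {r a b c d : ℕ}
    (hnd : [0, r, a, b, c, d].Nodup) (hlt : ∀ k ∈ [0, r, a, b, c, d], k < 2 ^ n)
    (h : searchPair n r a b c d = true) :
    HasSpanningPathPair (cube n) [vertexOfCode w 0, vertexOfCode w r] (vertexOfCode w a)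
      (vertexOfCode w b) (vertexOfCode w c) (vertexOfCode w d) := by
  obtain ⟨A, hA, p, hp⟩ := exists_walk_of_searchPath w (hlt a (by simp)) h
  obtain ⟨A', hA', q, hq⟩ := exists_walk_of_searchPath w (hlt c (by simp)) hA
  have hnone : codes n A' = [] := by simp [codes, eq_of_beq hA']
  rw [hnone, List.map_nil, List.append_nil] at hq
  refine ⟨p, q, (isEnumeration_map_vertexOfCode w).perm ?_⟩
  refine List.Perm.trans ?_ ((append_codes_maskCompl_perm hnd hlt).map _)
  refine List.perm_iff_count.2 fun x => ?_
  have hpx := hp.count_eq x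
  have hqx := hq.count_eq x
  simp only [List.map_append, List.map_cons, List.map_nil, List.count_append, List.count_cons,
    List.count_nil] at hpx hqx ⊢
  omega

-- The seven values of `r` are the nonzero codes of even weight below `16`, the eight candidates
-- for the ends are the codes of odd weight; `a < b`, `c < d` and `a < c` break the symmetry.
theorem searchPair_four_eq_true : ∀ r ∈ [3, 5, 6, 9, 10, 12, 15],
    ∀ a ∈ [1, 2, 4, 7, 8, 11, 13, 14], ∀ b ∈ [1, 2, 4, 7, 8, 11, 13, 14], a < b →
    ∀ c ∈ [1, 2, 4, 7, 8, 11, 13, 14], a < c → c ≠ b →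
    ∀ d ∈ [1, 2, 4, 7, 8, 11, 13, 14], c < d → d ≠ b → searchPair 4 r a b c d = true := by
  decide +kernel

theorem mem_of_parity_vertexOfCode_eq : ∀ (w : Vertex 4), ∀ k < 16, 0 ≠ k →
    parity (vertexOfCode w 0) = parity (vertexOfCode w k) → k ∈ [3, 5, 6, 9, 10, 12, 15] := by
  decide +kernel

theorem mem_of_parity_vertexOfCode_ne : ∀ (w : Vertex 4), ∀ k < 16,
    parity (vertexOfCode w k) ≠ parity (vertexOfCode w 0) →
      k ∈ [1, 2, 4, 7, 8, 11, 13, 14] := by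
  decide +kernel

theorem hasSpanningPathPair_vertexOfCode {w : Vertex 4} {r a b c d : ℕ} (hr : r < 16) (ha : a < 16)
    (hb : b < 16) (hc : c < 16) (hd : d < 16)
    (hE : IsEndChoice (vertexOfCode w 0) (vertexOfCode w r) (vertexOfCode w a) (vertexOfCode w b)
      (vertexOfCode w c) (vertexOfCode w d)) :
    HasSpanningPathPair (cube 4) [vertexOfCode w 0, vertexOfCode w r] (vertexOfCode w a)
      (vertexOfCode w b) (vertexOfCode w c) (vertexOfCode w d) := by
  wlog hab : a < b generalizing a b
  · exact (this hb ha hE.swap_left (by grind [hE.nodup])).swap_left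
  wlog hcd : c < d generalizing c d
  · exact (this hd hc hE.swap_right (by grind [hE.nodup])).swap_right
  wlog hac : a < c generalizing a b c d
  · exact (this hc hd hcd ha hb hE.swap_pairs hab (by grind [hE.nodup])).swap_pairs
  have hnd : [0, r, a, b, c, d].Nodup := List.Nodup.of_map (vertexOfCode w) hE.nodup_append
  refine hasSpanningPathPair_of_searchPair w hnd (by simp [*]) ?_
  have mem {k : ℕ} := mem_of_parity_vertexOfCode_ne w k
  exact searchPair_four_eq_true r
    (mem_of_parity_vertexOfCode_eq w r hr (by grind) hE.parity_eq)
    a (mem ha hE.parity_a) b (mem hb hE.parity_b) hab c (mem hc hE.parity_c) hac (by grind)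
    d (mem hd hE.parity_d) hcd (by grind)

theorem isTwoLaceable_four : IsTwoLaceable 4 := by
  intro r₁ r₂ a b c d hE
  obtain ⟨r, hr, rfl⟩ := exists_vertexOfCode_eq r₁ r₂
  obtain ⟨a, ha, rfl⟩ := exists_vertexOfCode_eq r₁ a
  obtain ⟨b, hb, rfl⟩ := exists_vertexOfCode_eq r₁ b
  obtain ⟨c, hc, rfl⟩ := exists_vertexOfCode_eq r₁ c
  obtain ⟨d, hd, rfl⟩ := exists_vertexOfCode_eq r₁ d
  have hsearch := hasSpanningPathPair_vertexOfCode (w := r₁) hr ha hb hc hd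
  rw [vertexOfCode_zero] at hsearch
  exact hsearch hE

theorem isTwoLaceable (hn : 4 ≤ n) : IsTwoLaceable n := by
  induction n, hn using Nat.le_induction with
  | base => exact isTwoLaceable_four
  | succ n hn ih => exact ih.succ hn

end ExhaustiveSearch

section PathCoverings

variable {V : Type*} {G : SimpleGraph V} {S : Set V} {a b c d : V}

theorem exists_endedPath_induce {w : G.Walk a b} (hw : w.IsPath) (hS : ∀ x ∈ w.support, x ∈ S) :
    ∃ p : EndedPath (G.induce S), p.ends.map Subtype.val = s(a, b) ∧
      ∀ x, x ∈ p.walk.support ↔ x.1 ∈ w.support :=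
  ⟨⟨_, _, w.induce S hS, .of_map (f := (SimpleGraph.Embedding.induce S).toHom) (by simpa)⟩, rfl,
    by simp⟩

theorem HasSpanningPathPair.exists_isPathCovering [DecidableEq V] {F : List V}
    (h : HasSpanningPathPair G F a b c d) (hS : ∀ x, x ∈ S ↔ x ∉ F) :
    ∃ (C : Finset (EndedPath (G.induce S))) (p q : EndedPath (G.induce S)),
      IsPathCovering (G.induce S) C ∧ p ≠ q ∧ (∀ e, e ∈ C ↔ e = p ∨ e = q) ∧
        p.ends.map Subtype.val = s(a, b) ∧ q.ends.map Subtype.val = s(c, d) := by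
  classical
  obtain ⟨v, w, hvw⟩ := h
  obtain ⟨-, hnd, hF⟩ := List.nodup_append.1 hvw.nodup
  obtain ⟨hv, hw, hdisj⟩ := List.nodup_append.1 hnd
  obtain ⟨p, hp, hpv⟩ := exists_endedPath_induce (S := S) ((v.isPath_def).2 hv) fun x hx =>
    (hS x).2 fun hxF => hF x hxF x (List.mem_append_left _ hx) rfl
  obtain ⟨q, hq, hqw⟩ := exists_endedPath_induce (S := S) ((w.isPath_def).2 hw) fun x hx =>
    (hS x).2 fun hxF => hF x hxF x (List.mem_append_right _ hx) rfl
  have hpq : ∀ x, x ∈ p.walk.support → x ∉ q.walk.support := fun x hxp hxq =>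
    hdisj x ((hpv x).1 hxp) x ((hqw x).1 hxq) rfl
  have hne : p ≠ q := by
    rintro rfl
    exact hpq p.fst p.walk.start_mem_support p.walk.start_mem_support
  refine ⟨{p, q}, p, q, ⟨?_, fun x => ?_⟩, hne, by simp, hp, hq⟩
  · simp only [Finset.mem_insert, Finset.mem_singleton]
    rintro _ (rfl | rfl) _ (rfl | rfl) hne' x hx hx'
    exacts [hne' rfl, hpq x hx hx', hpq x hx' hx, hne' rfl]
  · simp only [Finset.mem_insert, Finset.mem_singleton, exists_eq_or_imp, exists_eq_left, hpv, hqw]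
    exact List.mem_append.1 ((List.mem_append.1 (hvw.mem x)).resolve_left ((hS x).1 x.2))

theorem IsEndChoice.exists_isPathCovering {n : ℕ} (hn : 4 ≤ n) {r₁ r₂ a b c d : Vertex n}
    (hE : IsEndChoice r₁ r₂ a b c d) :
    ∃ (C : Finset (EndedPath (cubeMinus {r₁, r₂}))) (p q : EndedPath (cubeMinus {r₁, r₂})),
      IsPathCovering (cubeMinus {r₁, r₂}) C ∧ p ≠ q ∧ (∀ e, e ∈ C ↔ e = p ∨ e = q) ∧
        cubeEnds p = s(a, b) ∧ cubeEnds q = s(c, d) :=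
  (isTwoLaceable hn r₁ r₂ a b c d hE).exists_isPathCovering (by simp)

theorem twoPathClaim {n : ℕ} (hn : 4 ≤ n) (red : Bool) : TwoPathClaim red n := by
  classical
  rintro r₁ r₂ a b c d rfl hr₂ hr ha hb hc hd hab hac had hbc hbd hcd
  have hE : IsEndChoice r₁ r₂ a b c d := ⟨hr, hr₂.symm, ha, hb, hc, hd, by simp [*]⟩
  obtain ⟨C, p, q, hC, hpq, hmem, hp, hq⟩ := hE.exists_isPathCovering hn
  refine ⟨C, ⟨hC, Finset.card_eq_two.2 ⟨p, q, hpq, ?_⟩⟩, ⟨p, (hmem p).2 (.inl rfl), hp⟩,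
    q, (hmem q).2 (.inr rfl), hq⟩
  simp [Finset.ext_iff, hmem]

end PathCoverings

section Obstruction

variable {V : Type*} {G : SimpleGraph V} {a b c d s : V}

theorem EndedPath.mem_support_of_mem_ends {p : EndedPath G} {x : V} (hx : x ∈ p.ends) :
    x ∈ p.walk.support := by
  rcases Sym2.mem_iff.1 hx with rfl | rfl
  · exact p.walk.start_mem_support
  · exact p.walk.end_mem_support

theorem EndedPath.exists_isPath_of_ends_eq {p : EndedPath G} (hp : p.ends = s(a, b)) :
    ∃ w : G.Walk a b, w.IsPath ∧ ∀ x ∈ w.support, x ∈ p.walk.support := by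
  rcases Sym2.eq_iff.1 hp with ⟨rfl, rfl⟩ | ⟨rfl, rfl⟩
  · exact ⟨p.walk, p.isPath, fun _ hx => hx⟩
  · exact ⟨p.walk.reverse, p.isPath.reverse, by simp⟩

theorem exists_adj_mem_support_of_unique_neighbor {w : G.Walk a b} (hw : w.IsPath) (hab : a ≠ b)
    (hsb : s ≠ b) (ha : ∀ x, G.Adj a x → x = s) : ∃ x ∈ w.support, G.Adj s x ∧ x ≠ a := by
  cases w with
  | nil => exact absurd rfl hab
  | cons hax w =>
    obtain rfl := ha _ hax
    cases w with
    | nil => exact absurd rfl hsb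
    | cons hxy w =>
      refine ⟨_, by simp, hxy, ?_⟩
      rintro rfl
      simp at hw

theorem IsPathCovering.ends_ne {C : Finset (EndedPath G)} (hC : IsPathCovering G C)
    {p q : EndedPath G} (hp : p ∈ C) (hq : q ∈ C) (hab : a ≠ b) (hsb : s ≠ b) (hacd : a ∉ s(c, d))
    (ha : ∀ x, G.Adj a x → x = s) (hs : ∀ x, G.Adj s x → x = a ∨ x ∈ s(c, d))
    (hpe : p.ends = s(a, b)) : q.ends ≠ s(c, d) := by
  intro hqe
  have hpq : p ≠ q := by
    rintro rfl
    exact hacd (hqe ▸ hpe ▸ Sym2.mem_mk_left a b)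
  obtain ⟨w, hw, hwp⟩ := EndedPath.exists_isPath_of_ends_eq hpe
  obtain ⟨x, hxw, hsx, hxa⟩ := exists_adj_mem_support_of_unique_neighbor hw hab hsb ha
  have hxq : x ∈ q.ends := hqe ▸ (hs x hsx).resolve_left hxa
  exact hC.disjoint p hp q hq hpq x (hwp x hxw) (EndedPath.mem_support_of_mem_ends hxq)

theorem cubeEnds_eq_iff {n : ℕ} {F : Finset (Vertex n)} {p : EndedPath (cubeMinus F)}
    {x y : {x : Vertex n // x ∉ F}} : cubeEnds p = s(x.1, y.1) ↔ p.ends = s(x, y) :=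
  (Sym2.map.injective Subtype.val_injective).eq_iff (b := s(x, y))

theorem exists_isEndChoice_obstruction (red : Bool) :
    ∃ r₁ r₂ a b c d : Vertex 3, parity r₁ = red ∧ IsEndChoice r₁ r₂ a b c d ∧
      ∀ C : Finset (EndedPath (cubeMinus {r₁, r₂})), IsPathCovering (cubeMinus {r₁, r₂}) C →
        ∀ p ∈ C, ∀ q ∈ C, cubeEnds p = s(a, b) → cubeEnds q ≠ s(c, d) := by
  let F : Finset (Vertex 3) := {![red, false, true], ![red, true, false]}
  let s : {x // x ∉ F} := ⟨![!red, true, true], by decide +revert⟩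
  let a : {x // x ∉ F} := ⟨![red, true, true], by decide +revert⟩
  let b : {x // x ∉ F} := ⟨![red, false, false], by decide +revert⟩
  let c : {x // x ∉ F} := ⟨![!red, false, true], by decide +revert⟩
  let d : {x // x ∉ F} := ⟨![!red, true, false], by decide +revert⟩
  refine ⟨![red, false, true], ![red, true, false], a, b, c, d, by decide +revert,
    by constructor <;> decide +revert, ?_⟩
  obtain ⟨hab, hsb, hacd, neighbors_a, neighbors_s⟩ : a ≠ b ∧ s ≠ b ∧ a ∉ s(c, d) ∧
      (∀ x, (cubeMinus F).Adj a x → x = s) ∧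
        ∀ x, (cubeMinus F).Adj s x → x = a ∨ x ∈ s(c, d) := by
    decide +revert
  exact fun C hC p hp q hq hpe hqe => hC.ends_ne hp hq hab hsb hacd neighbors_a neighbors_s
    (cubeEnds_eq_iff.1 hpe) (cubeEnds_eq_iff.1 hqe)

theorem not_twoPathClaim_three (red : Bool) : ¬ TwoPathClaim red 3 := by
  intro h
  obtain ⟨r₁, r₂, a, b, c, d, rfl, ⟨hr, hp, ha, hb, hc, hd, hnd⟩, hobs⟩ :=
    exists_isEndChoice_obstruction red
  obtain ⟨⟨hab, hac, had⟩, ⟨hbc, hbd⟩, hcd⟩ :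
      (a ≠ b ∧ a ≠ c ∧ a ≠ d) ∧ (b ≠ c ∧ b ≠ d) ∧ c ≠ d := by
    simpa using hnd
  obtain ⟨C, ⟨hC, -⟩, ⟨p, hpC, hpe⟩, q, hqC, hqe⟩ :=
    h r₁ r₂ a b c d rfl hp.symm hr ha hb hc hd hab hac had hbc hbd hcd
  exact hobs C hC p hpC q hqC hpe hqe

end Obstruction

theorem ncard_sep_eq_card_iff {α : Type*} {s : Finset α} {P : α → Prop} :
    {x | x ∈ s ∧ P x}.ncard = s.card ↔ ∀ x ∈ s, P x := by
  classical
  rw [← Finset.card_filter_eq_iff, ← Finset.coe_filter, Set.ncard_coe_finset]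

theorem ncard_sep_eq_zero_iff {α : Type*} {s : Finset α} {P : α → Prop} :
    {x | x ∈ s ∧ P x}.ncard = 0 ↔ ∀ x ∈ s, ¬ P x := by
  classical
  rw [← Finset.card_filter_eq_zero_iff, ← Finset.coe_filter, Set.ncard_coe_finset]

section Pairs

variable {n : ℕ}

theorem pairOfParity_mk {b : Bool} {x y : Vertex n} :
    PairOfParity b s(x, y) ↔ parity x = b ∧ parity y = b := by
  simp [PairOfParity]

theorem isNeutralPair_mk {x y : Vertex n} : IsNeutralPair s(x, y) ↔ parity x ≠ parity y := by
  simp only [IsNeutralPair, Sym2.mem_iff]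
  grind

theorem isChargedPair_iff_not_isNeutralPair {e : Sym2 (Vertex n)} :
    IsChargedPair e ↔ ¬ IsNeutralPair e := by
  induction e with
  | _ x y =>
    simp only [IsChargedPair, pairOfParity_mk, isNeutralPair_mk, not_not]
    exact ⟨fun ⟨_, h, h'⟩ => h.trans h'.symm, fun h => ⟨_, h, rfl⟩⟩

theorem PairOfParity.not_pairOfParity {b : Bool} {e : Sym2 (Vertex n)}
    (h : PairOfParity (!b) e) : ¬ PairOfParity b e := by
  induction e with
  | _ x y => simp_all [pairOfParity_mk]

theorem isPairSet_pair_and_ne_iff {a b c d : Vertex n} :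
    IsPairSet {s(a, b), s(c, d)} ∧ s(a, b) ≠ s(c, d) ↔ [a, b, c, d].Nodup := by
  constructor
  · rintro ⟨⟨hdiag, hdisj⟩, hne⟩
    have hab : a ≠ b := by simpa using hdiag s(a, b) (by simp)
    have hcd : c ≠ d := by simpa using hdiag s(c, d) (by simp)
    have habcd : (a ≠ c ∧ a ≠ d) ∧ b ≠ c ∧ b ≠ d := by
      simpa using hdisj s(a, b) (by simp) s(c, d) (by simp) hne
    simp [hab, hcd, habcd]
  · intro h
    have hdisj : ∀ x ∈ s(a, b), x ∉ s(c, d) := by grind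
    have hab : a ≠ b := by grind
    have hcd : c ≠ d := by grind
    refine ⟨⟨by simp [hab, hcd], ?_⟩, fun heq => hdisj a (by simp) (heq ▸ Sym2.mem_mk_left a b)⟩
    simp only [Finset.mem_insert, Finset.mem_singleton]
    rintro _ (rfl | rfl) _ (rfl | rfl) hne x hx hx'
    exacts [hne rfl, hdisj x hx hx', hdisj x hx' hx, hne rfl]

end Pairs

section Balance

variable {n : ℕ} {F : Finset (Vertex n)} {E : Finset (Sym2 (Vertex n))} {b red : Bool}

theorem parityCount_add_parityCount_not : parityCount b F + parityCount (!b) F = F.card := by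
  simp only [parityCount, Bool.eq_not]
  exact Finset.card_filter_add_card_filter_not fun x => parity x = b

theorem parityCount_eq_card_iff : parityCount b F = F.card ↔ ∀ x ∈ F, parity x = b :=
  Finset.card_filter_eq_iff

theorem charge_eq_card_iff : charge F = F.card ↔ ∃ b, ∀ x ∈ F, parity x = b := by
  have h : parityCount true F + parityCount false F = F.card := parityCount_add_parityCount_not
  simp only [← parityCount_eq_card_iff, Bool.exists_bool, charge]
  omega

theorem pairCount_le_card : pairCount b E ≤ E.card := by
  rw [pairCount, ← Set.ncard_coe_finset]
  exact Set.ncard_le_ncard fun e he => he.1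

theorem inBalance_iff (red : Bool) : InBalance F E ↔ (∀ e ∈ E, ∀ x ∈ e, x ∉ F) ∧
    (parityCount red F : ℤ) - parityCount (!red) F = pairCount (!red) E - pairCount red E := by
  cases red
  · rw [InBalance, Bool.not_false]
    exact and_congr_right fun _ => by omega
  · rfl

theorem isAdmissible_card_iff (hF : ∀ x ∈ F, parity x = red) : IsAdmissible F 0 F.card E ↔
    IsPairSet E ∧ E.card = F.card ∧ ∀ e ∈ E, PairOfParity (!red) e := by
  have hred : parityCount red F = F.card := parityCount_eq_card_iff.2 hF
  have hgreen : parityCount (!red) F = 0 := by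
    have := parityCount_add_parityCount_not (b := red) (F := F)
    omega
  rw [IsAdmissible, inBalance_iff red, hred, hgreen, ncard_sep_eq_zero_iff]
  constructor
  · rintro ⟨hE, ⟨-, hbal⟩, hneutral, hcharged⟩
    rw [ncard_sep_eq_card_iff.2 fun e he =>
      isChargedPair_iff_not_isNeutralPair.2 (hneutral e he)] at hcharged
    have hle := pairCount_le_card (b := !red) (E := E)
    exact ⟨hE, hcharged, ncard_sep_eq_card_iff.1 (show pairCount (!red) E = E.card by omega)⟩
  · rintro ⟨hE, hcard, hpar⟩
    have hcharged : ∀ e ∈ E, IsChargedPair e := fun e he => ⟨_, hpar e he⟩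
    have hgreenPairs : pairCount (!red) E = E.card := ncard_sep_eq_card_iff.2 hpar
    have hredPairs : pairCount red E = 0 :=
      ncard_sep_eq_zero_iff.2 fun e he => (hpar e he).not_pairOfParity
    refine ⟨hE, ⟨fun e he x hx hxF => ?_, by omega⟩,
      fun e he => isChargedPair_iff_not_isNeutralPair.1 (hcharged e he),
      (ncard_sep_eq_card_iff.2 hcharged).trans hcard⟩
    exact Bool.not_ne_self red ((hpar e he x hx).symm.trans (hF x hxF))

end Balance

section TwoFaults

variable {n : ℕ} {r₁ r₂ : Vertex n}

theorem isAdmissible_pair_iff (hr : r₁ ≠ r₂) (hp : parity r₁ = parity r₂)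
    {E : Finset (Sym2 (Vertex n))} : IsAdmissible {r₁, r₂} 0 2 E ↔
      IsPairSet E ∧ E.card = 2 ∧ ∀ e ∈ E, PairOfParity (!parity r₁) e := by
  have h := isAdmissible_card_iff (E := E) (F := {r₁, r₂}) (red := parity r₁) (by simp [hp])
  rwa [Finset.card_pair hr] at h

theorem isAdmissible_pair_iff_exists_isEndChoice (hr : r₁ ≠ r₂) (hp : parity r₁ = parity r₂)
    {E : Finset (Sym2 (Vertex n))} : IsAdmissible {r₁, r₂} 0 2 E ↔
      ∃ a b c d, IsEndChoice r₁ r₂ a b c d ∧ E = {s(a, b), s(c, d)} := by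
  rw [isAdmissible_pair_iff hr hp]
  constructor
  · rintro ⟨hE, hcard, hpar⟩
    obtain ⟨⟨a, b⟩, ⟨c, d⟩, hne, rfl⟩ := Finset.card_eq_two.1 hcard
    obtain ⟨⟨ha, hb⟩, hc, hd⟩ :
        (parity a ≠ parity r₁ ∧ parity b ≠ parity r₁) ∧
          parity c ≠ parity r₁ ∧ parity d ≠ parity r₁ := by
      simpa [pairOfParity_mk, Bool.eq_not] using hpar
    exact ⟨a, b, c, d, ⟨hr, hp, ha, hb, hc, hd, isPairSet_pair_and_ne_iff.1 ⟨hE, hne⟩⟩, rfl⟩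
  · rintro ⟨a, b, c, d, hE, rfl⟩
    obtain ⟨hset, hne⟩ := isPairSet_pair_and_ne_iff.2 hE.nodup
    refine ⟨hset, Finset.card_pair hne, ?_⟩
    simp [pairOfParity_mk, Bool.eq_not, hE.parity_a, hE.parity_b, hE.parity_c, hE.parity_d]

theorem exists_isEndChoice (hn : 4 ≤ n) (hr : r₁ ≠ r₂) (hp : parity r₁ = parity r₂) :
    ∃ a b c d, IsEndChoice r₁ r₂ a b c d := by
  have hpar (i : Fin n) : parity (flipAt r₁ i) ≠ parity r₁ :=
    (parity_ne_of_adj (adj_flipAt ..)).symm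
  refine ⟨flipAt r₁ ⟨0, by omega⟩, flipAt r₁ ⟨1, by omega⟩, flipAt r₁ ⟨2, by omega⟩,
    flipAt r₁ ⟨3, by omega⟩, hr, hp, hpar _, hpar _, hpar _, hpar _, ?_⟩
  simp [(flipAt_injective r₁).eq_iff]

theorem canFreelyPrescribeEnds_pair (hn : 4 ≤ n) (hr : r₁ ≠ r₂) (hp : parity r₁ = parity r₂) :
    CanFreelyPrescribeEnds {r₁, r₂} 0 2 := by
  simp only [CanFreelyPrescribeEnds, isAdmissible_pair_iff_exists_isEndChoice hr hp]
  refine ⟨?_, ?_⟩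
  · obtain ⟨a, b, c, d, h⟩ := exists_isEndChoice hn hr hp
    exact ⟨_, a, b, c, d, h, rfl⟩
  · rintro _ ⟨a, b, c, d, h, rfl⟩
    obtain ⟨C, p, q, hC, -, hmem, hp, hq⟩ := h.exists_isPathCovering hn
    refine ⟨C, hC, ?_⟩
    ext e
    simp [hmem, hp, hq, eq_comm]

theorem isLeast_admissibleDims : IsLeast (admissibleDims 2 2 0 2) 4 := by
  refine ⟨⟨?_, fun n hn F hF hcharge => ?_⟩, ?_⟩
  · rw [Real.logb_le_iff_le_rpow (by norm_num) (by norm_num)]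
    norm_num
  · obtain ⟨red, hred⟩ := charge_eq_card_iff.1 (hcharge.trans hF.symm)
    obtain ⟨r₁, r₂, hr, rfl⟩ := Finset.card_eq_two.1 hF
    exact canFreelyPrescribeEnds_pair hn hr ((hred r₁ (by simp)).trans (hred r₂ (by simp)).symm)
  · rintro m ⟨-, hm⟩
    by_contra! hlt
    obtain ⟨r₁, r₂, a, b, c, d, -, hE, hobs⟩ := exists_isEndChoice_obstruction true
    have hcard : ({r₁, r₂} : Finset (Vertex 3)).card = 2 := Finset.card_pair hE.ne
    have hcharge : charge {r₁, r₂} = 2 :=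
      (charge_eq_card_iff.2 ⟨parity r₁, by simp [hE.parity_eq]⟩).trans hcard
    obtain ⟨C, hC, hends⟩ := (hm 3 (by omega) _ hcard hcharge).2 _
      ((isAdmissible_pair_iff_exists_isEndChoice hE.ne hE.parity_eq).2 ⟨a, b, c, d, hE, rfl⟩)
    have hmem : ∀ e ∈ ({s(a, b), s(c, d)} : Finset _), ∃ p ∈ C, cubeEnds p = e := fun e he =>
      (Set.ext_iff.1 hends e).2 he
    obtain ⟨p, hpC, hpe⟩ := hmem s(a, b) (by simp)
    obtain ⟨q, hqC, hqe⟩ := hmem s(c, d) (by simp)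
    exact hobs C hC p hpC q hqC hpe hqe

end TwoFaults

end HypercubePaths

theorem mainTheorem10 :
    (∀ (red : Bool) (n : ℕ), 4 ≤ n → HypercubePaths.TwoPathClaim red n) ∧
    (∀ red : Bool, ¬ HypercubePaths.TwoPathClaim red 3) ∧
    IsLeast (HypercubePaths.admissibleDims 2 2 0 2) 4 :=
  ⟨fun red _ hn => HypercubePaths.twoPathClaim hn red, HypercubePaths.not_twoPathClaim_three,
    HypercubePaths.isLeast_admissibleDims⟩
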